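/- Setting. Let $\Gamma$ be a countably infinite, totally ordered set of values. A schema $\mathcal G$ consists of relation names with arities and of a set of integrity constraints of two kinds: denial constraints $\forall \vec x_1,\dots,\vec x_m\ \neg[g_1(\vec x_1)\wedge\dots\wedge g_m(\vec x_m)\wedge\sigma(\vec x_1,\dots,\vec x_m)]$ with $m\ge 1$, where $\sigma$ is a conjunction of comparisons $X\odot X'$, $\odot\in\{\le,\ge,<,>,\ne\}$, between variables occurring in $\vec x_1,\dots,\vec x_m$; and inclusion dependencies $\forall\vec x_\forall\,[\,\exists \vec x_{1\exists}\, g_1(\vec x_1)\to\exists\vec x_{2\exists}\,g_2(\vec x_2)\,]$, where the variables within each $\vec x_i$ are distinct, $\vec x_\forall$ are the variables common to $\vec x_1$ and $\vec x_2$, and $\vec x_{i\exists}$ are the remaining variables of $\vec x_i$. The inclusion dependencies may be cyclic. A database is a set of facts $g(t)$ with $t$ a tuple over $\Gamma$ of the arity of $g$. A CM-complete repair of a database $D$ is a subset of $D$ that satisfies all constraints and is not strictly contained in another such subset. A query $q(\vec x)$ is a union of conjunctive queries, i.e. a non-empty disjunction of existentially quantified conjunctions $g_1(\vec y_1)\wedge\dots\wedge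 g_m(\vec y_m)\wedge\sigma(\vec y_1,\dots,\vec y_m)$ of the same form as above ($m\ge1$), each with free variables $\vec x$. A tuple $t$ over $\Gamma$ is a consistent answer to $q$ if $t$ is an answer to $q$ in every CM-complete repair of $D$. Program. $P_{cqa}$ uses predicates $g, g^c, g^r$ for each relation name $g$, and $Q_{cqa}$. It consists of the following rules: (1) for each denial constraint as above, $g_1^c(\vec x_1)\vee\dots\vee g_m^c(\vec x_m)\leftarrow g_1(\vec x_1),\dots,g_m(\vec x_m),\sigma(\vec x_1,\dots,\vec x_m)$; (2) for each inclusion dependency as above with $|\vec x_{2\exists}|>0$, $g_1^c(\vec x_1)\leftarrow g_1(\vec x_1),\ \#\mathrm{count}\{\vec x_{2\exists}:g_2^c(\vec x_2)\}=\#\mathrm{count}\{\vec x_{2\exists}:g_2(\vec x_2)\}$; and for each one with $|\vec x_{2\exists}|=0$, the two rules $g_1^c(\vec x_1)\leftarrow g_1(\vec x_1),g_2^c(\vec x_2)$ and $g_1^c(\vec x_1)\leftarrow g_1(\vec x_1),\mathrm{not}\ g_2(\vec x_2)$; (3) for each relation name $g$, $g^r(\vec x)\leftarrow g(\vec x),\mathrm{not}\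 g^c(\vec x)$; (4) for each disjunct of $q(\vec x)$ as above, $Q_{cqa}(\vec x)\leftarrow g_1^r(\vec y_1),\dots,g_m^r(\vec y_m),\sigma(\vec y_1,\dots,\vec y_m)$. An answer set of a program is a set $A$ of ground atoms that is a $\subseteq$-minimal model of the set of those ground instances of rules whose body is true in $A$ (the Faber–Leone–Pfeifer semantics for programs with possibly recursive aggregates). A cautious consequence is a ground atom true in every answer set. Theorem. Let $D$ be a finite, possibly inconsistent database for a schema $\mathcal G$ with arbitrary denial constraints and possibly cyclic inclusion dependencies, and let $q$ be a union of conjunctive queries. Then a tuple $t$ is a consistent answer to $q$ w.r.t. $D$ under the CM-complete semantics if and only if $Q_{cqa}(t)$ is a cautious consequence of $D\cup P_{cqa}$. Moreover, the map $A\mapsto\{g(t): g^r(t)\in A\}$ is a bijection from the answer sets of $D\cup P_{cqa}$ onto the CM-complete repairs of $D$. -/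

import Mathlib

namespace CQA

/-! ### Relational databases, integrity constraints and queries -/

/-- Variables. -/
abbrev Var := ℕ

/-- The comparison operators `≤, ≥, <, >, ≠`
(equality is expressed by repeating a variable). -/
inductive Cmp where
  | le | ge | lt | gt | ne

def Cmp.Holds {Γ : Type*} [LinearOrder Γ] : Cmp → Γ → Γ → Prop
  | .le, a, b => a ≤ b
  | .ge, a, b => a ≥ b
  | .lt, a, b => a < b
  | .gt, a, b => a > b
  | .ne, a, b => a ≠ b

/-- An atom `p(x₁, …, xₙ)` with `n = ar p`, over predicate symbols `P` with arities `ar`,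
and with arguments in `T`.  For `T` a set of values this is a fact. -/
@[ext]
structure Atom {P : Type*} (ar : P → ℕ) (T : Type*) where
  pred : P
  args : Fin (ar pred) → T

def Atom.map {P T U : Type*} {ar : P → ℕ} (f : T → U) (a : Atom ar T) : Atom ar U :=
  ⟨a.pred, fun i => f (a.args i)⟩

/-- A comparison atom `X ⊙ X'`. -/
structure Comparison where
  left : Var
  op : Cmp
  right : Var

/-- The variable `x` occurs in one of the atoms of the list. -/
def OccursIn {P : Type*} {ar : P → ℕ} (x : Var) (l : List (Atom ar Var)) : Prop :=
  ∃ a ∈ l, ∃ i, a.args i = x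

/-- A conjunction `r₁(x₁) ∧ … ∧ rₘ(xₘ) ∧ σ(x₁, …, xₘ)` with `m ≥ 1`. -/
structure Conj {R : Type*} (ar : R → ℕ) where
  atoms : List (Atom ar Var)
  comps : List Comparison
  atoms_ne : atoms ≠ []
  safe : ∀ c ∈ comps, OccursIn c.left atoms ∧ OccursIn c.right atoms

/-- Truth of a conjunction in the database `B` under the valuation `ν`. -/
def Conj.Holds {R Γ : Type*} [LinearOrder Γ] {ar : R → ℕ} (c : Conj ar)
    (B : Set (Atom ar Γ)) (ν : Var → Γ) : Prop :=
  (∀ a ∈ c.atoms, a.map ν ∈ B) ∧ ∀ k ∈ c.comps, k.op.Holds (ν k.left) (ν k.right)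

/-- An inclusion dependency `r₁(x₁) → ∃ x₂∃, r₂(x₂)`.  The variables within `x₁` are distinct,
and so are those within `x₂`.  The variables shared by `x₁` and `x₂` are the universally
quantified `x∀`; the other variables of `x₂` are existentially quantified. -/
structure IND {R : Type*} (ar : R → ℕ) where
  lhs : Atom ar Var
  rhs : Atom ar Var
  lhs_inj : Function.Injective lhs.args
  rhs_inj : Function.Injective rhs.args

/-- The sequence `x₂∃ = x₂ - x∀`. -/
def IND.exVars {R : Type*} {ar : R → ℕ} (d : IND ar) : List Var :=
  (List.ofFn d.rhs.args).filter (fun x => x ∉ List.ofFn d.lhs.args)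

/-- A database schema on the relation names `R`: arities, denial constraints
(a conjunction `c` stands for `∀ x₁ … xₘ, ¬ c`) and inclusion dependencies. -/
structure Schema (R : Type*) where
  arity : R → ℕ
  dcs : Set (Conj arity)
  inds : Set (IND arity)

/-- A set of facts over the schema, with values in `Γ`. -/
abbrev Database {R : Type*} (G : Schema R) (Γ : Type*) := Set (Atom G.arity Γ)

/-- `B` satisfies the denial constraint `∀ x₁ … xₘ, ¬ c`. -/
def SatisfiesDC {R Γ : Type*} [LinearOrder Γ] {ar : R → ℕ} (B : Set (Atom ar Γ))
    (c : Conj ar) : Prop :=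
  ∀ ν : Var → Γ, ¬ c.Holds B ν

/-- `B` satisfies the inclusion dependency `d`. -/
def SatisfiesIND {R Γ : Type*} {ar : R → ℕ} (B : Set (Atom ar Γ)) (d : IND ar) : Prop :=
  ∀ ν : Var → Γ, d.lhs.map ν ∈ B →
    ∃ w : Var → Γ, (∀ x ∈ Set.range d.lhs.args ∩ Set.range d.rhs.args, w x = ν x) ∧
      d.rhs.map w ∈ B

/-- `B` is consistent: all integrity constraints of the schema hold. -/
def Consistent {R Γ : Type*} [LinearOrder Γ] (G : Schema R) (B : Database G Γ) : Prop :=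
  (∀ c ∈ G.dcs, SatisfiesDC B c) ∧ ∀ d ∈ G.inds, SatisfiesIND B d

/-- A CM-complete repair of `D`: a consistent subset of `D` not strictly contained
in another one. -/
def IsCMRepair {R Γ : Type*} [LinearOrder Γ] (G : Schema R) (D B : Database G Γ) : Prop :=
  Consistent G B ∧ B ⊆ D ∧ ¬ ∃ B' : Database G Γ, B' ⊆ D ∧ Consistent G B' ∧ B ⊂ B'

/-- A union of conjunctive queries `cq₁(x) ∨ … ∨ cqₙ(x)` with `n ≥ 1`; `free` is the sequence
`x` of its free variables (without duplicates), each of which occurs in every disjunct.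
All other variables of a disjunct are existentially quantified. -/
structure UCQ {R : Type*} (ar : R → ℕ) where
  arity : ℕ
  free : Fin arity → Var
  free_inj : Function.Injective free
  disjuncts : List (Conj ar)
  disjuncts_ne : disjuncts ≠ []
  free_occurs : ∀ c ∈ disjuncts, ∀ i, OccursIn (free i) c.atoms

/-- The answer to the query `q` in the database `B`. -/
def UCQ.ans {R Γ : Type*} [LinearOrder Γ] {ar : R → ℕ} (q : UCQ ar) (B : Set (Atom ar Γ)) :
    Set (Fin q.arity → Γ) :=
  {t | ∃ c ∈ q.disjuncts, ∃ ν : Var → Γ, (∀ i, ν (q.free i) = t i) ∧ c.Holds B ν}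

/-- The consistent answer under the CM-complete semantics. -/
def ansCM {R Γ : Type*} [LinearOrder Γ] (G : Schema R) (D : Database G Γ) (q : UCQ G.arity) :
    Set (Fin q.arity → Γ) :=
  {t | ∀ B : Database G Γ, IsCMRepair G D B → t ∈ q.ans B}

/-! ### Disjunctive answer set programming with count aggregates -/

/-- A term: a variable or a constant. -/
inductive Term (Γ : Type*) where
  | var (x : Var)
  | const (a : Γ)

def Term.eval {Γ : Type*} (ν : Var → Γ) : Term Γ → Γ
  | .var x => ν x
  | .const a => a

/-- A symbolic set `{vars : conj}`.  The variables in `vars` are local to the set, all others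
are global. -/
structure SymbolicSet {P : Type*} (ar : P → ℕ) (Γ : Type*) where
  vars : List Var
  conj : List (Atom ar (Term Γ))

/-- Body literals: `a`, `not a`, `s ⊙ t`, and `#count S = #count T`. -/
inductive Literal {P : Type*} (ar : P → ℕ) (Γ : Type*) where
  | pos (a : Atom ar (Term Γ))
  | naf (a : Atom ar (Term Γ))
  | cmp (s : Term Γ) (op : Cmp) (t : Term Γ)
  | countEq (S T : SymbolicSet ar Γ)

/-- A rule: its head is read disjunctively, its body conjunctively. -/
structure Rule {P : Type*} (ar : P → ℕ) (Γ : Type*) where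
  head : List (Atom ar (Term Γ))
  body : List (Literal ar Γ)

/-- The value of a symbolic set in the interpretation `I`, the global variables being
instantiated by `ν`: the set of those instances of the sequence `vars` for which the
conjunction is true. -/
def SymbolicSet.value {P Γ : Type*} {ar : P → ℕ} (S : SymbolicSet ar Γ)
    (I : Set (Atom ar Γ)) (ν : Var → Γ) : Set (List Γ) :=
  {l | ∃ w : Var → Γ, (∀ x, x ∉ S.vars → w x = ν x) ∧
    (∀ a ∈ S.conj, a.map (Term.eval w) ∈ I) ∧ l = S.vars.map w}

def Literal.Holds {P Γ : Type*} [LinearOrder Γ] {ar : P → ℕ} (I : Set (Atom ar Γ))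
    (ν : Var → Γ) : Literal ar Γ → Prop
  | .pos a => a.map (Term.eval ν) ∈ I
  | .naf a => a.map (Term.eval ν) ∉ I
  | .cmp s op t => op.Holds (s.eval ν) (t.eval ν)
  | .countEq S T => (S.value I ν).encard = (T.value I ν).encard

def Rule.BodyHolds {P Γ : Type*} [LinearOrder Γ] {ar : P → ℕ} (r : Rule ar Γ)
    (I : Set (Atom ar Γ)) (ν : Var → Γ) : Prop :=
  ∀ l ∈ r.body, l.Holds I ν

def Rule.HeadHolds {P Γ : Type*} {ar : P → ℕ} (r : Rule ar Γ)
    (I : Set (Atom ar Γ)) (ν : Var → Γ) : Prop :=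
  ∃ a ∈ r.head, a.map (Term.eval ν) ∈ I

/-- The ground instances (a rule with an instantiation of its variables by constants) of the
program `Pr` whose body is true in `A`: the reduct of `Pr` with respect to `A` in the semantics
of Faber, Leone and Pfeifer for programs with (recursive) aggregates. -/
def reduct {P Γ : Type*} [LinearOrder Γ] {ar : P → ℕ} (Pr : Set (Rule ar Γ))
    (A : Set (Atom ar Γ)) : Set (Rule ar Γ × (Var → Γ)) :=
  {g | g.1 ∈ Pr ∧ g.1.BodyHolds A g.2}

/-- `I` is a model of a set of ground instances of rules. -/
def IsModel {P Γ : Type*} [LinearOrder Γ] {ar : P → ℕ} (S : Set (Rule ar Γ × (Var → Γ)))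
    (I : Set (Atom ar Γ)) : Prop :=
  ∀ g ∈ S, g.1.BodyHolds I g.2 → g.1.HeadHolds I g.2

/-- `A` is an answer set of `Pr`: a subset-minimal model of the reduct of `Pr` with respect
to `A`. -/
def IsAnswerSet {P Γ : Type*} [LinearOrder Γ] {ar : P → ℕ} (Pr : Set (Rule ar Γ))
    (A : Set (Atom ar Γ)) : Prop :=
  Minimal (IsModel (reduct Pr A)) A

/-- The ground atom `a` is a cautious consequence of `Pr`: it is true in every answer set. -/
def CautiousConsequence {P Γ : Type*} [LinearOrder Γ] {ar : P → ℕ} (Pr : Set (Rule ar Γ))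
    (a : Atom ar Γ) : Prop :=
  ∀ A, IsAnswerSet Pr A → a ∈ A

/-! ### The generated program -/

/-- The predicates of the generated program: `g`, `gᶜ`, `gʳ` for each relation name `g`, and
the query predicate. -/
inductive CqaPred (R : Type*) where
  | base (g : R)
  | del (g : R)
  | rep (g : R)
  | query

def cqaArity {R : Type*} (ar : R → ℕ) (n : ℕ) : CqaPred R → ℕ
  | .base g => ar g
  | .del g => ar g
  | .rep g => ar g
  | .query => n

section Generated

variable {R : Type*} {ar : R → ℕ}

/-- `g(x)` as an atom of the generated program. -/
def baseAtom {T : Type*} (n : ℕ) (a : Atom ar T) : Atom (cqaArity ar n) T :=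
  ⟨.base a.pred, a.args⟩

/-- `gᶜ(x)`. -/
def delAtom {T : Type*} (n : ℕ) (a : Atom ar T) : Atom (cqaArity ar n) T :=
  ⟨.del a.pred, a.args⟩

/-- `gʳ(x)`. -/
def repAtom {T : Type*} (n : ℕ) (a : Atom ar T) : Atom (cqaArity ar n) T :=
  ⟨.rep a.pred, a.args⟩

/-- `Q_cqa(x)`. -/
def queryAtom {T : Type*} (ar : R → ℕ) {n : ℕ} (t : Fin n → T) : Atom (cqaArity ar n) T :=
  ⟨.query, t⟩

/-- An atom on variables as an atom on terms. -/
def Atom.toTerm (Γ : Type*) (a : Atom ar Var) : Atom ar (Term Γ) := a.map Term.var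

/-- The fact `g(t)` as a rule with empty body. -/
def factRule {Γ : Type*} (n : ℕ) (f : Atom ar Γ) : Rule (cqaArity ar n) Γ where
  head := [baseAtom n (f.map Term.const)]
  body := []

def compLit (Γ : Type*) (n : ℕ) (k : Comparison) : Literal (cqaArity ar n) Γ :=
  .cmp (.var k.left) k.op (.var k.right)

/-- `g₁ᶜ(x₁) ∨ ⋯ ∨ gₘᶜ(xₘ) :- g₁(x₁), …, gₘ(xₘ), σ(x₁, …, xₘ).` -/
def dcRule (Γ : Type*) (n : ℕ) (c : Conj ar) : Rule (cqaArity ar n) Γ where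
  head := c.atoms.map fun a => delAtom n (a.toTerm Γ)
  body := (c.atoms.map fun a => .pos (baseAtom n (a.toTerm Γ))) ++ c.comps.map (compLit Γ n)

/-- `g₁ᶜ(x₁) :- g₁(x₁), #count{x₂∃ : g₂ᶜ(x₂)} = #count{x₂∃ : g₂(x₂)}.` -/
def indCountRule (Γ : Type*) (n : ℕ) (d : IND ar) : Rule (cqaArity ar n) Γ where
  head := [delAtom n (d.lhs.toTerm Γ)]
  body := [.pos (baseAtom n (d.lhs.toTerm Γ)),
    .countEq ⟨d.exVars, [delAtom n (d.rhs.toTerm Γ)]⟩ ⟨d.exVars, [baseAtom n (d.rhs.toTerm Γ)]⟩]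

/-- `g₁ᶜ(x₁) :- g₁(x₁), g₂ᶜ(x₂).` -/
def indDelRule (Γ : Type*) (n : ℕ) (d : IND ar) : Rule (cqaArity ar n) Γ where
  head := [delAtom n (d.lhs.toTerm Γ)]
  body := [.pos (baseAtom n (d.lhs.toTerm Γ)), .pos (delAtom n (d.rhs.toTerm Γ))]

/-- `g₁ᶜ(x₁) :- g₁(x₁), not g₂(x₂).` -/
def indNotRule (Γ : Type*) (n : ℕ) (d : IND ar) : Rule (cqaArity ar n) Γ where
  head := [delAtom n (d.lhs.toTerm Γ)]
  body := [.pos (baseAtom n (d.lhs.toTerm Γ)), .naf (baseAtom n (d.rhs.toTerm Γ))]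

/-- The rules generated for an inclusion dependency. -/
def indRules (Γ : Type*) (n : ℕ) (d : IND ar) : Set (Rule (cqaArity ar n) Γ) :=
  {r | (0 < d.exVars.length ∧ r = indCountRule Γ n d) ∨
    (d.exVars.length = 0 ∧ (r = indDelRule Γ n d ∨ r = indNotRule Γ n d))}

/-- The atom `g(X₁, …, Xₖ)` on distinct variables. -/
def genericAtom (ar : R → ℕ) (g : R) : Atom ar Var := ⟨g, fun i => (i : ℕ)⟩

/-- `gʳ(x) :- g(x), not gᶜ(x).` -/
def repRule (ar : R → ℕ) (Γ : Type*) (n : ℕ) (g : R) : Rule (cqaArity ar n) Γ where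
  head := [repAtom n ((genericAtom ar g).toTerm Γ)]
  body := [.pos (baseAtom n ((genericAtom ar g).toTerm Γ)),
    .naf (delAtom n ((genericAtom ar g).toTerm Γ))]

/-- `Q_cqa(x) :- g₁ʳ(y₁), …, gₘʳ(yₘ), σ(y₁, …, yₘ).` for a disjunct of the query. -/
def queryRule (Γ : Type*) (q : UCQ ar) (c : Conj ar) : Rule (cqaArity ar q.arity) Γ where
  head := [queryAtom ar fun i => .var (q.free i)]
  body := (c.atoms.map fun a => .pos (repAtom q.arity (a.toTerm Γ))) ++
    c.comps.map (compLit Γ q.arity)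

end Generated

/-- The program `P_cqa` generated from the schema and the query (CM-complete semantics). -/
def Pcqa {R : Type*} (G : Schema R) (Γ : Type*) (q : UCQ G.arity) :
    Set (Rule (cqaArity G.arity q.arity) Γ) :=
  {r | (∃ c ∈ G.dcs, r = dcRule Γ q.arity c) ∨
    (∃ d ∈ G.inds, r ∈ indRules Γ q.arity d) ∨
    (∃ g : R, r = repRule G.arity Γ q.arity g) ∨
    (∃ c ∈ q.disjuncts, r = queryRule Γ q c)}

/-- The database as a set of rules. -/
def factProgram {R Γ : Type*} {G : Schema R} (D : Database G Γ) (n : ℕ) :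
    Set (Rule (cqaArity G.arity n) Γ) :=
  factRule n '' D

/-- The database `{g(t) : gʳ(t) ∈ A}` described by an interpretation of the generated
program. -/
def repairedDB {R Γ : Type*} (G : Schema R) {n : ℕ} (A : Set (Atom (cqaArity G.arity n) Γ)) :
    Database G Γ :=
  {f | repAtom n f ∈ A}

end CQA

/-! A set of ground atoms is the same thing as four extensions: `D` of the `g`, `C` of the `gᶜ`
(deletions), `B` of the `gʳ`, and `Q` of the query predicate. Supportedness (`cqaProgram_supported`)
bounds these from above in any answer set, and the rules bound them from below, so the base facts
are the database, `B = D \ C` and `Q` is the answer to the query in `B`. Only `C` is free.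

The core is `isModel_reduct_iff`: for `C' ⊆ C ⊆ D`, lowering the deletions to `C'` still gives a
model of the reduct exactly when `D \ C'` is consistent, `B'` contains `D \ C` and `Q'` contains the
answers in `B'`. The bound on `B'` involves the old `C`, since the reduct drops the `gʳ` instances
of facts in `C`; so `C` can shrink while `B` and `Q` stay put. Minimality of the answer set thus
becomes minimality of `C` among deletions leaving a consistent set, that is, maximality of `D \ C`.

Cycles of inclusion dependencies do no harm: over finite `D`, the count equality says that no
witness survives deletion, and this persists when more facts are deleted. An instance violated for
`C'` therefore already has a rule in the reduct for `C`. -/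

namespace CQA

/-! ### Supportedness of answer sets -/

section Supported

variable {P Γ : Type*} [LinearOrder Γ] {ar : P → ℕ}

/-- Every atom of an answer set occurs in the head of a rule instance whose body is true. -/
theorem IsAnswerSet.supported {Pr : Set (Rule ar Γ)} {A : Set (Atom ar Γ)}
    (hA : IsAnswerSet Pr A) {a : Atom ar Γ} (ha : a ∈ A) :
    ∃ r ∈ Pr, ∃ ν : Var → Γ, r.BodyHolds A ν ∧ ∃ h ∈ r.head, h.map (Term.eval ν) = a := by
  by_contra hcon
  push Not at hcon
  -- Instances in the reduct have a body true in `A`, so their heads are met in `A`, and by an atom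
  -- other than `a`. Whether the body holds in `A \ {a}` plays no role.
  have hmodel : IsModel (reduct Pr A) (A \ {a}) := by
    rintro ⟨r, ν⟩ ⟨hr, hbody⟩ -
    obtain ⟨h, hh, hhA⟩ := hA.prop ⟨r, ν⟩ ⟨hr, hbody⟩ hbody
    exact ⟨h, hh, hhA, hcon r hr ν hbody h hh⟩
  exact (hA.le_of_le hmodel Set.sdiff_subset ha).2 rfl

end Supported

/-! ### Interpretations as quadruples of extensions -/

section Interpretations

variable {R Γ : Type*} {ar : R → ℕ} {n : ℕ}

/-- The interpretation of the generated program with the given extensions of the predicates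
`g`, `gᶜ`, `gʳ` and of the query predicate. -/
def interp (D C B : Set (Atom ar Γ)) (Q : Set (Fin n → Γ)) : Set (Atom (cqaArity ar n) Γ) :=
  {a | match a with
    | ⟨.base g, t⟩ => (⟨g, t⟩ : Atom ar Γ) ∈ D
    | ⟨.del g, t⟩ => (⟨g, t⟩ : Atom ar Γ) ∈ C
    | ⟨.rep g, t⟩ => (⟨g, t⟩ : Atom ar Γ) ∈ B
    | ⟨.query, t⟩ => t ∈ Q}

variable {D C B D' C' B' : Set (Atom ar Γ)} {Q Q' : Set (Fin n → Γ)}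

@[simp] theorem baseAtom_mem_interp {f : Atom ar Γ} :
    baseAtom n f ∈ interp D C B Q ↔ f ∈ D := Iff.rfl

@[simp] theorem delAtom_mem_interp {f : Atom ar Γ} :
    delAtom n f ∈ interp D C B Q ↔ f ∈ C := Iff.rfl

@[simp] theorem repAtom_mem_interp {f : Atom ar Γ} :
    repAtom n f ∈ interp D C B Q ↔ f ∈ B := Iff.rfl

@[simp] theorem queryAtom_mem_interp {t : Fin n → Γ} :
    queryAtom ar t ∈ interp D C B Q ↔ t ∈ Q := Iff.rfl

theorem baseAtom_injective :
    Function.Injective (baseAtom n : Atom ar Γ → Atom (cqaArity ar n) Γ) := by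
  rintro ⟨g, t⟩ ⟨g', t'⟩ h
  cases h
  rfl

theorem delAtom_injective :
    Function.Injective (delAtom n : Atom ar Γ → Atom (cqaArity ar n) Γ) := by
  rintro ⟨g, t⟩ ⟨g', t'⟩ h
  cases h
  rfl

theorem repAtom_injective :
    Function.Injective (repAtom n : Atom ar Γ → Atom (cqaArity ar n) Γ) := by
  rintro ⟨g, t⟩ ⟨g', t'⟩ h
  cases h
  rfl

theorem interp_subset_interp :
    interp D C B Q ⊆ interp D' C' B' Q' ↔ D ⊆ D' ∧ C ⊆ C' ∧ B ⊆ B' ∧ Q ⊆ Q' := by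
  constructor
  · intro h
    exact ⟨fun f hf => h (baseAtom_mem_interp.2 hf : baseAtom n f ∈ _),
      fun f hf => h (delAtom_mem_interp.2 hf : delAtom n f ∈ _),
      fun f hf => h (repAtom_mem_interp.2 hf : repAtom n f ∈ _),
      fun t ht => h (queryAtom_mem_interp.2 ht : queryAtom ar t ∈ _)⟩
  · rintro ⟨hD, hC, hB, hQ⟩ ⟨g | g | g | _, t⟩ h
    exacts [hD h, hC h, hB h, hQ h]

theorem eq_interp (A : Set (Atom (cqaArity ar n) Γ)) :
    A = interp {f | baseAtom n f ∈ A} {f | delAtom n f ∈ A} {f | repAtom n f ∈ A}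
      {t | queryAtom ar t ∈ A} := by
  ext ⟨g | g | g | _, t⟩ <;> exact Iff.rfl

end Interpretations

/-! ### Meaning of the denial, repair, query and fact rules -/

section Rules

variable {R Γ : Type*} [LinearOrder Γ] {ar : R → ℕ} {n : ℕ}
  {D C B : Set (Atom ar Γ)} {Q : Set (Fin n → Γ)} {ν : Var → Γ}

theorem dcRule_bodyHolds (c : Conj ar) :
    (dcRule Γ n c).BodyHolds (interp D C B Q) ν ↔ c.Holds D ν := by
  simp only [Rule.BodyHolds, dcRule, List.mem_append, List.mem_map, Conj.Holds]
  constructor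
  · intro h
    exact ⟨fun a ha => h _ (Or.inl ⟨a, ha, rfl⟩), fun k hk => h _ (Or.inr ⟨k, hk, rfl⟩)⟩
  · rintro ⟨h₁, h₂⟩ l (⟨a, ha, rfl⟩ | ⟨k, hk, rfl⟩)
    exacts [h₁ a ha, h₂ k hk]

omit [LinearOrder Γ] in
theorem dcRule_headHolds (c : Conj ar) :
    (dcRule Γ n c).HeadHolds (interp D C B Q) ν ↔ ∃ a ∈ c.atoms, a.map ν ∈ C := by
  simp only [Rule.HeadHolds, dcRule, List.mem_map, exists_exists_and_eq_and]
  exact Iff.rfl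

theorem queryRule_bodyHolds {q : UCQ ar} {Q : Set (Fin q.arity → Γ)} (c : Conj ar) :
    (queryRule Γ q c).BodyHolds (interp D C B Q) ν ↔ c.Holds B ν := by
  simp only [Rule.BodyHolds, queryRule, List.mem_append, List.mem_map, Conj.Holds]
  constructor
  · intro h
    exact ⟨fun a ha => h _ (Or.inl ⟨a, ha, rfl⟩), fun k hk => h _ (Or.inr ⟨k, hk, rfl⟩)⟩
  · rintro ⟨h₁, h₂⟩ l (⟨a, ha, rfl⟩ | ⟨k, hk, rfl⟩)
    exacts [h₁ a ha, h₂ k hk]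

omit [LinearOrder Γ] in
theorem queryRule_headHolds {q : UCQ ar} {Q : Set (Fin q.arity → Γ)} (c : Conj ar) :
    (queryRule Γ q c).HeadHolds (interp D C B Q) ν ↔ (fun i => ν (q.free i)) ∈ Q := by
  simp only [Rule.HeadHolds, queryRule, List.mem_singleton, exists_eq_left]
  exact Iff.rfl

theorem repRule_bodyHolds (g : R) :
    (repRule ar Γ n g).BodyHolds (interp D C B Q) ν ↔
      (genericAtom ar g).map ν ∈ D ∧ (genericAtom ar g).map ν ∉ C := by
  simp only [Rule.BodyHolds, repRule, List.forall_mem_cons, List.not_mem_nil, false_imp_iff,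
    implies_true, and_true]
  exact Iff.rfl

omit [LinearOrder Γ] in
theorem repRule_headHolds (g : R) :
    (repRule ar Γ n g).HeadHolds (interp D C B Q) ν ↔ (genericAtom ar g).map ν ∈ B := by
  simp only [Rule.HeadHolds, repRule, List.mem_singleton, exists_eq_left]
  exact Iff.rfl

omit [LinearOrder Γ] in
theorem exists_map_genericAtom [Nonempty Γ] (f : Atom ar Γ) :
    ∃ ν : Var → Γ, (genericAtom ar f.pred).map ν = f := by
  obtain ⟨a⟩ := ‹Nonempty Γ›
  -- The `i`-th argument of `genericAtom` is the variable `i`; values beyond the arity are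
  -- immaterial.
  refine ⟨fun x => if h : x < ar f.pred then f.args ⟨x, h⟩ else a, ?_⟩
  obtain ⟨g, t⟩ := f
  simp [genericAtom, Atom.map]

theorem factRule_bodyHolds (f : Atom ar Γ) (I : Set (Atom (cqaArity ar n) Γ)) :
    (factRule n f).BodyHolds I ν := by
  simp [Rule.BodyHolds, factRule]

omit [LinearOrder Γ] in
theorem factRule_headHolds (f : Atom ar Γ) :
    (factRule n f).HeadHolds (interp D C B Q) ν ↔ f ∈ D := by
  simp only [Rule.HeadHolds, factRule, List.mem_singleton, exists_eq_left]
  exact Iff.rfl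

end Rules

/-! ### Inclusion dependencies and their count rules -/

section InclusionDependencies

variable {R Γ : Type*} {ar : R → ℕ}

theorem IND.mem_exVars {d : IND ar} {x : Var} :
    x ∈ d.exVars ↔ x ∈ Set.range d.rhs.args ∧ x ∉ Set.range d.lhs.args := by
  simp [IND.exVars, List.mem_filter, List.mem_ofFn]

theorem map_eq_map_iff {a : Atom ar Var} {v w : Var → Γ} :
    a.map v = a.map w ↔ ∀ x ∈ Set.range a.args, v x = w x := by
  simp [Atom.map, funext_iff]

/-- No fact of `B` is a witness for the instance `ν` of the inclusion dependency `d`. -/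
def IND.Unwitnessed (d : IND ar) (B : Set (Atom ar Γ)) (ν : Var → Γ) : Prop :=
  ∀ w : Var → Γ, (∀ x, x ∉ d.exVars → w x = ν x) → d.rhs.map w ∉ B

/-- Passes to the convention of symbolic sets, where a witness valuation agrees with `ν` at every
non-local variable. Variables outside the right-hand atom do not affect the witness, so it can be
reset to `ν` there. -/
theorem satisfiesIND_iff {B : Set (Atom ar Γ)} {d : IND ar} :
    SatisfiesIND B d ↔ ∀ ν : Var → Γ, d.lhs.map ν ∈ B → ¬ d.Unwitnessed B ν := by
  refine forall_congr' fun ν => imp_congr_right fun _ => ?_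
  simp only [IND.Unwitnessed, not_forall, not_not, exists_prop]
  constructor
  · rintro ⟨w, hw, hB⟩
    refine ⟨fun x => if x ∈ d.exVars then w x else ν x, fun x hx => if_neg hx, ?_⟩
    convert hB using 1
    refine map_eq_map_iff.2 fun x hx => ?_
    by_cases hex : x ∈ d.exVars
    · exact if_pos hex
    · rw [if_neg hex, hw x ⟨?_, hx⟩]
      by_contra hl
      exact hex (IND.mem_exVars.2 ⟨hx, hl⟩)
  · rintro ⟨w, hw, hB⟩
    exact ⟨w, fun x hx => hw x fun hex => (IND.mem_exVars.1 hex).2 hx.1, hB⟩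

theorem IND.Unwitnessed.mono {d : IND ar} {B B' : Set (Atom ar Γ)} {ν : Var → Γ}
    (h : d.Unwitnessed B' ν) (hB : B ⊆ B') : d.Unwitnessed B ν :=
  fun w hw hwB => h w hw (hB hwB)

variable [LinearOrder Γ] {n : ℕ} {D C B : Set (Atom ar Γ)} {Q : Set (Fin n → Γ)} {ν : Var → Γ}

omit [LinearOrder Γ] in
theorem value_del_eq (d : IND ar) :
    SymbolicSet.value (ar := cqaArity ar n) ⟨d.exVars, [delAtom n (d.rhs.toTerm Γ)]⟩
        (interp D C B Q) ν =
      (d.exVars.map ·) '' {w | (∀ x, x ∉ d.exVars → w x = ν x) ∧ d.rhs.map w ∈ C} := by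
  ext l
  simp only [SymbolicSet.value, List.mem_singleton, forall_eq, Set.mem_ofPred_eq, Set.mem_image,
    and_assoc, eq_comm (a := l)]
  exact Iff.rfl

omit [LinearOrder Γ] in
theorem value_base_eq (d : IND ar) :
    SymbolicSet.value (ar := cqaArity ar n) ⟨d.exVars, [baseAtom n (d.rhs.toTerm Γ)]⟩
        (interp D C B Q) ν =
      (d.exVars.map ·) '' {w | (∀ x, x ∉ d.exVars → w x = ν x) ∧ d.rhs.map w ∈ D} := by
  ext l
  simp only [SymbolicSet.value, List.mem_singleton, forall_eq, Set.mem_ofPred_eq, Set.mem_image,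
    and_assoc, eq_comm (a := l)]
  exact Iff.rfl

omit [LinearOrder Γ] in
theorem finite_witnesses (hD : D.Finite) (d : IND ar) (ν : Var → Γ) :
    {w : Var → Γ | (∀ x, x ∉ d.exVars → w x = ν x) ∧ d.rhs.map w ∈ D}.Finite := by
  refine Set.Finite.of_injOn (f := d.rhs.map) (fun w hw => hw.2) ?_ hD
  intro v hv w hw hvw
  funext x
  by_cases hx : x ∈ d.exVars
  · exact map_eq_map_iff.1 hvw x (IND.mem_exVars.1 hx).1
  · rw [hv.1 x hx, hw.1 x hx]

/-- The valuations counted for `C` are among those counted for `D`. Finiteness makes equal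
cardinality force equality of the two sets, so no witness lies in `D \ C`; for infinite sets this
would fail. -/
theorem indCountRule_bodyHolds (hD : D.Finite) (hC : C ⊆ D) (d : IND ar) :
    (indCountRule Γ n d).BodyHolds (interp D C B Q) ν ↔
      d.lhs.map ν ∈ D ∧ d.Unwitnessed (D \ C) ν := by
  simp only [Rule.BodyHolds, indCountRule, List.forall_mem_cons, List.not_mem_nil,
    false_imp_iff, implies_true, and_true]
  refine and_congr Iff.rfl ?_
  simp only [Literal.Holds, value_del_eq, value_base_eq]
  set S := {w : Var → Γ | (∀ x, x ∉ d.exVars → w x = ν x) ∧ d.rhs.map w ∈ C}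
  set T := {w : Var → Γ | (∀ x, x ∉ d.exVars → w x = ν x) ∧ d.rhs.map w ∈ D}
  have hST : S ⊆ T := fun w hw => ⟨hw.1, hC hw.2⟩
  have hfin : T.Finite := finite_witnesses hD d ν
  have hinj : Set.InjOn (d.exVars.map ·) T := by
    intro v hv w hw hvw
    funext x
    by_cases hx : x ∈ d.exVars
    · exact List.map_inj_left.1 hvw x hx
    · rw [hv.1 x hx, hw.1 x hx]
  rw [(hinj.mono hST).encard_image, hinj.encard_image]
  constructor
  · intro h w hw hwB
    have : S = T := (hfin.subset hST).eq_of_subset_of_encard_le hST h.ge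
    have hwS : w ∈ S := this ▸ ⟨hw, hwB.1⟩
    exact hwB.2 hwS.2
  · intro h
    congr 1
    exact hST.antisymm fun w hw => ⟨hw.1, by_contra fun hwC => h w hw.1 ⟨hw.2, hwC⟩⟩

omit [LinearOrder Γ] in
theorem unwitnessed_of_exVars_eq_nil {d : IND ar} (h : d.exVars = []) :
    d.Unwitnessed B ν ↔ d.rhs.map ν ∉ B := by
  simp only [IND.Unwitnessed, h, List.not_mem_nil, not_false_eq_true, true_imp_iff]
  constructor
  · exact fun H => H ν fun _ => rfl
  · intro H w hw
    rwa [show w = ν from funext hw]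

theorem indDelRule_bodyHolds (d : IND ar) :
    (indDelRule Γ n d).BodyHolds (interp D C B Q) ν ↔ d.lhs.map ν ∈ D ∧ d.rhs.map ν ∈ C := by
  simp only [Rule.BodyHolds, indDelRule, List.forall_mem_cons, List.not_mem_nil, false_imp_iff,
    implies_true, and_true]
  exact Iff.rfl

theorem indNotRule_bodyHolds (d : IND ar) :
    (indNotRule Γ n d).BodyHolds (interp D C B Q) ν ↔ d.lhs.map ν ∈ D ∧ d.rhs.map ν ∉ D := by
  simp only [Rule.BodyHolds, indNotRule, List.forall_mem_cons, List.not_mem_nil, false_imp_iff,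
    implies_true, and_true]
  exact Iff.rfl

omit [LinearOrder Γ] in
theorem indRules_head {d : IND ar} {r : Rule (cqaArity ar n) Γ} (hr : r ∈ indRules Γ n d) :
    r.head = [delAtom n (d.lhs.toTerm Γ)] := by
  rcases hr with ⟨-, rfl⟩ | ⟨-, rfl | rfl⟩ <;> rfl

omit [LinearOrder Γ] in
theorem indRules_headHolds {d : IND ar} {r : Rule (cqaArity ar n) Γ}
    (hr : r ∈ indRules Γ n d) :
    r.HeadHolds (interp D C B Q) ν ↔ d.lhs.map ν ∈ C := by
  simp only [Rule.HeadHolds, indRules_head hr, List.mem_singleton, exists_eq_left]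
  exact Iff.rfl

theorem indRules_lhs_mem {d : IND ar} {r : Rule (cqaArity ar n) Γ} (hr : r ∈ indRules Γ n d)
    (h : r.BodyHolds (interp D C B Q) ν) : d.lhs.map ν ∈ D := by
  rcases hr with ⟨-, rfl⟩ | ⟨-, rfl | rfl⟩
  · exact h (.pos (baseAtom n (d.lhs.toTerm Γ))) (by simp [indCountRule])
  · exact ((indDelRule_bodyHolds d).1 h).1
  · exact ((indNotRule_bodyHolds d).1 h).1

theorem unwitnessed_of_bodyHolds (hD : D.Finite) (hC : C ⊆ D) {d : IND ar}
    {r : Rule (cqaArity ar n) Γ} (hr : r ∈ indRules Γ n d)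
    (h : r.BodyHolds (interp D C B Q) ν) : d.Unwitnessed (D \ C) ν := by
  rcases hr with ⟨-, rfl⟩ | ⟨hnil, rfl | rfl⟩
  · exact ((indCountRule_bodyHolds hD hC d).1 h).2
  · rw [unwitnessed_of_exVars_eq_nil (List.length_eq_zero_iff.1 hnil)]
    exact fun h' => h'.2 ((indDelRule_bodyHolds d).1 h).2
  · rw [unwitnessed_of_exVars_eq_nil (List.length_eq_zero_iff.1 hnil)]
    exact fun h' => ((indNotRule_bodyHolds d).1 h).2 h'.1

/-- If deletions `C'` leave an instance of `d` without witness, then the body of one of the rules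
for `d` is true for `C'` and for every larger set `C` of deletions. -/
theorem exists_indRules_bodyHolds {C' B' : Set (Atom ar Γ)} {Q' : Set (Fin n → Γ)}
    (hD : D.Finite) (hC : C ⊆ D) (hC' : C' ⊆ C) {d : IND ar} (hl : d.lhs.map ν ∈ D)
    (h : d.Unwitnessed (D \ C') ν) :
    ∃ r ∈ indRules Γ n d, r.BodyHolds (interp D C B Q) ν ∧ r.BodyHolds (interp D C' B' Q') ν := by
  rcases Nat.eq_zero_or_pos d.exVars.length with hnil | hpos
  · rw [unwitnessed_of_exVars_eq_nil (List.length_eq_zero_iff.1 hnil)] at h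
    -- Without existential variables the only candidate witness is `d.rhs.map ν`: either it was
    -- deleted or it was never in `D`, one rule for each case.
    by_cases hr : d.rhs.map ν ∈ D
    · have hr' : d.rhs.map ν ∈ C' := by_contra fun hn => h ⟨hr, hn⟩
      exact ⟨_, Or.inr ⟨hnil, Or.inl rfl⟩, (indDelRule_bodyHolds d).2 ⟨hl, hC' hr'⟩,
        (indDelRule_bodyHolds d).2 ⟨hl, hr'⟩⟩
    · exact ⟨_, Or.inr ⟨hnil, Or.inr rfl⟩, (indNotRule_bodyHolds d).2 ⟨hl, hr⟩,
        (indNotRule_bodyHolds d).2 ⟨hl, hr⟩⟩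
  · exact ⟨_, Or.inl ⟨hpos, rfl⟩,
      (indCountRule_bodyHolds hD hC d).2 ⟨hl, h.mono (Set.sdiff_subset_sdiff_right hC')⟩,
      (indCountRule_bodyHolds hD (hC'.trans hC) d).2 ⟨hl, h⟩⟩

end InclusionDependencies

/-! ### Answer sets of the generated program are the repairs -/

section AnswerSets

variable {R Γ : Type*} [LinearOrder Γ] {G : Schema R} {D : Database G Γ} {q : UCQ G.arity}

/-- The program generated for the schema, the query and the database. -/
abbrev cqaProgram (G : Schema R) (D : Database G Γ) (q : UCQ G.arity) :
    Set (Rule (cqaArity G.arity q.arity) Γ) :=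
  factProgram D q.arity ∪ Pcqa G Γ q

omit [LinearOrder Γ] in
theorem factRule_mem {f : Atom G.arity Γ} (hf : f ∈ D) :
    factRule q.arity f ∈ cqaProgram G D q := Or.inl ⟨f, hf, rfl⟩

omit [LinearOrder Γ] in
theorem dcRule_mem {c : Conj G.arity} (hc : c ∈ G.dcs) :
    dcRule Γ q.arity c ∈ cqaProgram G D q := Or.inr (Or.inl ⟨c, hc, rfl⟩)

omit [LinearOrder Γ] in
theorem indRules_subset {d : IND G.arity} (hd : d ∈ G.inds) :
    indRules Γ q.arity d ⊆ cqaProgram G D q :=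
  fun _ hr => Or.inr (Or.inr (Or.inl ⟨d, hd, hr⟩))

omit [LinearOrder Γ] in
theorem repRule_mem (g : R) : repRule G.arity Γ q.arity g ∈ cqaProgram G D q :=
  Or.inr (Or.inr (Or.inr (Or.inl ⟨g, rfl⟩)))

omit [LinearOrder Γ] in
theorem queryRule_mem {c : Conj G.arity} (hc : c ∈ q.disjuncts) :
    queryRule Γ q c ∈ cqaProgram G D q := Or.inr (Or.inr (Or.inr (Or.inr ⟨c, hc, rfl⟩)))

theorem Conj.Holds.mono {ar : R → ℕ} {c : Conj ar} {B B' : Set (Atom ar Γ)} {ν : Var → Γ}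
    (h : c.Holds B ν) (hB : B ⊆ B') : c.Holds B' ν :=
  ⟨fun a ha => hB (h.1 a ha), h.2⟩

/-- Denial and inclusion rules give consistency of `D \ C'`, with bodies that remain true from `C'`
up to `C`. The `gʳ` instances present are those of facts outside `C`, and they still fire for `C' ⊆
C`; hence `D \ C` rather than `D \ C'`. -/
theorem isModel_reduct_iff [Nonempty Γ] (hD : D.Finite) {C C' B B' : Database G Γ}
    {Q Q' : Set (Fin q.arity → Γ)} (hC : C ⊆ D) (hC' : C' ⊆ C) (hB : B' ⊆ B) :
    IsModel (reduct (cqaProgram G D q) (interp D C B Q)) (interp D C' B' Q') ↔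
      Consistent G (D \ C') ∧ D \ C ⊆ B' ∧ q.ans B' ⊆ Q' := by
  constructor
  · intro h
    refine ⟨⟨fun c hc ν hν => ?_, fun d hd => ?_⟩, fun f hf => ?_, ?_⟩
    · have hbody := hν.mono Set.sdiff_subset
      obtain ⟨a, ha, haC⟩ := (dcRule_headHolds c).1
        (h ⟨_, ν⟩ ⟨dcRule_mem hc, (dcRule_bodyHolds c).2 hbody⟩ ((dcRule_bodyHolds c).2 hbody))
      exact (hν.1 a ha).2 haC
    · refine satisfiesIND_iff.2 fun ν hl hun => ?_
      obtain ⟨r, hr, hA, hI⟩ := exists_indRules_bodyHolds (n := q.arity) (B := B) (Q := Q)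
        (B' := B') (Q' := Q') hD hC hC' hl.1 hun
      exact hl.2 ((indRules_headHolds hr).1 (h ⟨r, ν⟩ ⟨indRules_subset hd hr, hA⟩ hI))
    · obtain ⟨ν, hν⟩ := exists_map_genericAtom f
      rw [← hν]
      exact (repRule_headHolds _).1 (h ⟨_, ν⟩
        ⟨repRule_mem f.pred, (repRule_bodyHolds _).2 (by rw [hν]; exact hf)⟩
        ((repRule_bodyHolds _).2 (by rw [hν]; exact ⟨hf.1, fun hfC => hf.2 (hC' hfC)⟩)))
    · rintro t ⟨c, hc, ν, hν, hholds⟩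
      rw [← funext hν]
      exact (queryRule_headHolds c).1 (h ⟨_, ν⟩
        ⟨queryRule_mem hc, (queryRule_bodyHolds c).2 (hholds.mono hB)⟩
        ((queryRule_bodyHolds c).2 hholds))
  · rintro ⟨⟨hdc, hind⟩, hrep, hans⟩ ⟨r, ν⟩ ⟨hr, hA⟩ hI
    simp only at hr hA hI ⊢
    rcases hr with ⟨f, hf, rfl⟩ | ⟨c, hc, rfl⟩ | ⟨d, hd, hr⟩ | ⟨g, rfl⟩ | ⟨c, hc, rfl⟩
    · exact (factRule_headHolds f).2 hf
    · rw [dcRule_bodyHolds] at hI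
      rw [dcRule_headHolds]
      by_contra hcon
      push Not at hcon
      exact hdc c hc ν ⟨fun a ha => ⟨hI.1 a ha, hcon a ha⟩, hI.2⟩
    · rw [indRules_headHolds hr]
      by_contra hcon
      exact satisfiesIND_iff.1 (hind d hd) ν ⟨indRules_lhs_mem hr hI, hcon⟩
        (unwitnessed_of_bodyHolds hD (hC'.trans hC) hr hI)
    -- The only rule for which truth of the body in the larger interpretation, not in the smaller,
    -- is what counts.
    · rw [repRule_bodyHolds] at hA
      exact (repRule_headHolds g).2 (hrep hA)
    · rw [queryRule_bodyHolds] at hI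
      exact (queryRule_headHolds c).2 (hans ⟨c, hc, ν, fun _ => rfl, hI⟩)

/-- The extensions of the predicates in an answer set are bounded by the rules defining them. -/
theorem cqaProgram_supported {C B E : Database G Γ} {Q : Set (Fin q.arity → Γ)}
    (hA : IsAnswerSet (cqaProgram G D q) (interp E C B Q)) :
    E ⊆ D ∧ C ⊆ E ∧ B ⊆ E \ C ∧ Q ⊆ q.ans B := by
  refine ⟨fun f hf => ?_, fun f hf => ?_, fun f hf => ?_, fun t ht => ?_⟩
  · have hf' : baseAtom q.arity f ∈ interp E C B Q := hf
    obtain ⟨r, hr, ν, hbody, h, hh, heq⟩ := hA.supported hf'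
    rcases hr with ⟨f', hD', rfl⟩ | ⟨c, hc, rfl⟩ | ⟨d, hd, hr⟩ | ⟨g, rfl⟩ | ⟨c, hc, rfl⟩
    · obtain rfl := List.mem_singleton.1 hh
      obtain rfl : f' = f := baseAtom_injective heq
      exact hD'
    · obtain ⟨a, -, rfl⟩ := List.mem_map.1 hh
      cases heq
    · rw [indRules_head hr, List.mem_singleton] at hh
      subst hh
      cases heq
    · obtain rfl := List.mem_singleton.1 hh
      cases heq
    · obtain rfl := List.mem_singleton.1 hh
      cases heq
  · have hf' : delAtom q.arity f ∈ interp E C B Q := hf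
    obtain ⟨r, hr, ν, hbody, h, hh, heq⟩ := hA.supported hf'
    rcases hr with ⟨f', hD', rfl⟩ | ⟨c, hc, rfl⟩ | ⟨d, hd, hr⟩ | ⟨g, rfl⟩ | ⟨c, hc, rfl⟩
    · obtain rfl := List.mem_singleton.1 hh
      cases heq
    · obtain ⟨a, ha, rfl⟩ := List.mem_map.1 hh
      obtain rfl : a.map ν = f := delAtom_injective heq
      exact ((dcRule_bodyHolds c).1 hbody).1 a ha
    · have hl := indRules_lhs_mem hr hbody
      rw [indRules_head hr, List.mem_singleton] at hh
      subst hh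
      obtain rfl : d.lhs.map ν = f := delAtom_injective heq
      exact hl
    · obtain rfl := List.mem_singleton.1 hh
      cases heq
    · obtain rfl := List.mem_singleton.1 hh
      cases heq
  · have hf' : repAtom q.arity f ∈ interp E C B Q := hf
    obtain ⟨r, hr, ν, hbody, h, hh, heq⟩ := hA.supported hf'
    rcases hr with ⟨f', hD', rfl⟩ | ⟨c, hc, rfl⟩ | ⟨d, hd, hr⟩ | ⟨g, rfl⟩ | ⟨c, hc, rfl⟩
    · obtain rfl := List.mem_singleton.1 hh
      cases heq
    · obtain ⟨a, ha, rfl⟩ := List.mem_map.1 hh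
      cases heq
    · rw [indRules_head hr, List.mem_singleton] at hh
      subst hh
      cases heq
    · obtain rfl := List.mem_singleton.1 hh
      obtain rfl : (genericAtom G.arity g).map ν = f := repAtom_injective heq
      exact (repRule_bodyHolds g).1 hbody
    · obtain rfl := List.mem_singleton.1 hh
      cases heq
  · have ht' : queryAtom G.arity t ∈ interp E C B Q := ht
    obtain ⟨r, hr, ν, hbody, h, hh, heq⟩ := hA.supported ht'
    rcases hr with ⟨f', hD', rfl⟩ | ⟨c, hc, rfl⟩ | ⟨d, hd, hr⟩ | ⟨g, rfl⟩ | ⟨c, hc, rfl⟩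
    · obtain rfl := List.mem_singleton.1 hh
      cases heq
    · obtain ⟨a, ha, rfl⟩ := List.mem_map.1 hh
      cases heq
    · rw [indRules_head hr, List.mem_singleton] at hh
      subst hh
      cases heq
    · obtain rfl := List.mem_singleton.1 hh
      cases heq
    · obtain rfl := List.mem_singleton.1 hh
      cases heq
      exact ⟨c, hc, ν, fun _ => rfl, (queryRule_bodyHolds c).1 hbody⟩

/-- The interpretation of the generated program determined by a repair. -/
def repairInterp (D : Database G Γ) (q : UCQ G.arity) (B : Database G Γ) :
    Set (Atom (cqaArity G.arity q.arity) Γ) :=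
  interp D (D \ B) B (q.ans B)

theorem subset_base_of_isModel [Nonempty Γ] {E C B : Database G Γ} {Q : Set (Fin q.arity → Γ)}
    {A : Set (Atom (cqaArity G.arity q.arity) Γ)}
    (h : IsModel (reduct (cqaProgram G D q) A) (interp E C B Q)) : D ⊆ E := by
  obtain ⟨a⟩ := ‹Nonempty Γ›
  exact fun f hf => (factRule_headHolds f).1
    (h ⟨_, fun _ => a⟩ ⟨factRule_mem hf, factRule_bodyHolds f _⟩ (factRule_bodyHolds f _))

theorem IsAnswerSet.exists_repair [Nonempty Γ] (hD : D.Finite)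
    {A : Set (Atom (cqaArity G.arity q.arity) Γ)} (hA : IsAnswerSet (cqaProgram G D q) A) :
    ∃ B, IsCMRepair G D B ∧ A = repairInterp D q B := by
  obtain ⟨E, C, B, Q, rfl⟩ : ∃ E C B Q, A = interp E C B Q := ⟨_, _, _, _, eq_interp A⟩
  obtain ⟨hE, hC, hB, hQ⟩ := cqaProgram_supported hA
  obtain rfl : E = D := hE.antisymm (subset_base_of_isModel hA.prop)
  obtain ⟨hcons, hrep, hans⟩ := (isModel_reduct_iff hD hC subset_rfl subset_rfl).1 hA.prop
  obtain rfl : B = E \ C := hB.antisymm hrep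
  obtain rfl : Q = q.ans (E \ C) := hQ.antisymm hans
  refine ⟨E \ C, ⟨hcons, Set.sdiff_subset, ?_⟩, ?_⟩
  · rintro ⟨B', hB'E, hB'cons, hlt⟩
    have hsub : E \ B' ⊆ C := fun f hf => by_contra fun hfC => hf.2 (hlt.subset ⟨hf.1, hfC⟩)
    -- A larger consistent `B'` would permit fewer deletions. Only the deletions are lowered: `E \
    -- C` is kept as the extension of the `gʳ`, so the new model lies below the answer set.
    have hmodel : IsModel (reduct (cqaProgram G E q) (interp E C (E \ C) (q.ans (E \ C))))
        (interp E (E \ B') (E \ C) (q.ans (E \ C))) :=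
      (isModel_reduct_iff hD hC hsub subset_rfl).2
        ⟨by rwa [Set.sdiff_sdiff_cancel_left hB'E], subset_rfl, subset_rfl⟩
    have hle := hA.le_of_le hmodel
      (interp_subset_interp.2 ⟨subset_rfl, hsub, subset_rfl, subset_rfl⟩)
    have hCB' := (interp_subset_interp.1 hle).2.1
    exact hlt.not_subset fun f hf => ⟨hB'E hf, fun hfC => (hCB' hfC).2 hf⟩
  · rw [repairInterp, Set.sdiff_sdiff_cancel_left hC]

theorem IsCMRepair.isAnswerSet [Nonempty Γ] (hD : D.Finite) {B : Database G Γ}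
    (hB : IsCMRepair G D B) : IsAnswerSet (cqaProgram G D q) (repairInterp D q B) := by
  obtain ⟨hcons, hBD, hmax⟩ := hB
  refine ⟨(isModel_reduct_iff hD Set.sdiff_subset subset_rfl subset_rfl).2 ⟨?_, ?_, subset_rfl⟩,
    fun I hI hle => ?_⟩
  · rwa [Set.sdiff_sdiff_cancel_left hBD]
  · rw [Set.sdiff_sdiff_cancel_left hBD]
  · obtain ⟨E, C', B', Q', rfl⟩ : ∃ E C B Q, I = interp E C B Q := ⟨_, _, _, _, eq_interp I⟩
    obtain ⟨hE, hC', hB', hQ'⟩ := interp_subset_interp.1 hle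
    obtain rfl : E = D := hE.antisymm (subset_base_of_isModel hI)
    obtain ⟨hcons', hrep, hans⟩ := (isModel_reduct_iff hD Set.sdiff_subset hC' hB').1 hI
    rw [Set.sdiff_sdiff_cancel_left hBD] at hrep
    obtain rfl : B' = B := hB'.antisymm hrep
    refine interp_subset_interp.2 ⟨subset_rfl, fun f hf => by_contra fun hfC => hmax ?_,
      subset_rfl, hans⟩
    -- A fact `f` outside `B` but not in `C'` makes `E \ C'` a consistent strict superset of `B`,
    -- against maximality.
    exact ⟨E \ C', Set.sdiff_subset, hcons', fun g hg => ⟨hBD hg, fun hgC => (hC' hgC).2 hg⟩,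
      fun hsub => hf.2 (hsub ⟨hf.1, hfC⟩)⟩

theorem repairedDB_repairInterp (B : Database G Γ) :
    repairedDB G (repairInterp D q B) = B := rfl

theorem isAnswerSet_iff [Nonempty Γ] (hD : D.Finite)
    {A : Set (Atom (cqaArity G.arity q.arity) Γ)} :
    IsAnswerSet (cqaProgram G D q) A ↔ ∃ B, IsCMRepair G D B ∧ A = repairInterp D q B :=
  ⟨fun hA => hA.exists_repair hD, by rintro ⟨B, hB, rfl⟩; exact hB.isAnswerSet hD⟩

end AnswerSets

end CQA

theorem mainTheorem5 {R Γ : Type*} [LinearOrder Γ] [Countable Γ] [Infinite Γ]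
    (G : CQA.Schema R) (D : CQA.Database G Γ) (hD : D.Finite) (q : CQA.UCQ G.arity) :
    (∀ t : Fin q.arity → Γ,
      t ∈ CQA.ansCM G D q ↔
        CQA.CautiousConsequence (CQA.factProgram D q.arity ∪ CQA.Pcqa G Γ q)
          (CQA.queryAtom G.arity t)) ∧
    Set.BijOn (CQA.repairedDB G)
      {A | CQA.IsAnswerSet (CQA.factProgram D q.arity ∪ CQA.Pcqa G Γ q) A}
      {B | CQA.IsCMRepair G D B} := by
  refine ⟨fun t => ⟨fun ht A hA => ?_, fun ht B hB => ht _ (hB.isAnswerSet hD)⟩, ?_, ?_, ?_⟩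
  -- In `repairInterp D q B` the query atom for `t` is true exactly when `t` is an answer in `B`, by
  -- definition.
  · obtain ⟨B, hB, rfl⟩ := (CQA.isAnswerSet_iff hD).1 hA
    exact ht B hB
  · intro A hA
    obtain ⟨B, hB, rfl⟩ := (CQA.isAnswerSet_iff hD).1 hA
    exact hB
  · intro A hA A' hA' heq
    obtain ⟨B, -, rfl⟩ := (CQA.isAnswerSet_iff hD).1 hA
    obtain ⟨B', -, rfl⟩ := (CQA.isAnswerSet_iff hD).1 hA'
    rw [CQA.repairedDB_repairInterp, CQA.repairedDB_repairInterp] at heq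
    rw [heq]
  · exact fun B hB => ⟨_, hB.isAnswerSet hD, CQA.repairedDB_repairInterp B⟩
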